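/- Let $\mu$ be a finite positive Borel measure on the unit circle $\mathbb T$ whose support is an infinite set (for instance $\mathbb T$ or a nondegenerate arc). Put $\langle p,q\rangle=\int p\,\overline{q}\,d\mu$, let $\rho_k$ be the monic orthogonal polynomial of degree $k$ of $\mu$, write $P^*(z)=z^k\overline{P(1/\overline z)}$ for the reciprocal of a polynomial $P$ regarded as an element of the space of polynomials of degree at most $k$ (so $\rho_k^*$ is taken with this $k$), and let $F_k(z)=z\rho_{k-1}(z)/\rho_{k-1}^*(z)$. For $\tau\in\mathbb T$, a $\tau$-invariant $(n,3)$-QPOPUC (quasi-paraorthogonal polynomial of degree $n$ and order $3$) is a polynomial $P$ of degree $n$ with $P=\tau P^*$ (with $k=n$) and $\langle P,z^k\rangle=0$ for $2\le k\le n-2$. For distinct $a,b,c\in\mathbb T$, the arc $(a,b,c)$ is the open arc of $\mathbb T$ that runs from $a$ over $b$ to $c$; its orientation is counterclockwise or clockwise according to the order in which $a,b,c$ are met. Let $n\ge 3$, let $\tau\in\mathbb T$, and let $\alpha_1,\alpha_2\in\mathbb T$ be distinct. Put $f_i=\overline{F_{n-1}(\alpha_i)}$, and assume $f_1\ne f_2$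 and $\alpha_1f_1\neq\alpha_2f_2$. Let $$\eta=\overline{\left(\frac{f_1-f_2}{f_1\alpha_1-f_2\alpha_2}\right)}+\tau\,\overline{\left(\frac{\alpha_1-\alpha_2}{f_1\alpha_1-f_2\alpha_2}\right)} .$$ The following two conditions on $\tau$ are equivalent: (i) the points $\alpha_1,\tau f_1,\alpha_2$ are distinct, the points $\alpha_1,\tau f_1,\tau f_2$ are distinct, and the arcs $(\alpha_1,\tau f_1,\alpha_2)$ and $(\alpha_1,\tau f_1,\tau f_2)$ have opposite orientation; (ii) $\tau$ lies in the open arc $\left(\alpha_1\overline{f_2},\ -\dfrac{\overline{f_1}-\overline{f_2}}{|f_1-f_2|}\,\dfrac{\alpha_1-\alpha_2}{|\alpha_1-\alpha_2|},\ \alpha_2\overline{f_1}\right)$. If they hold, then $|\eta|<1$, and $$Q_{n,3}(z)=z(z-\eta)\rho_{n-2}(z)+\tau(1-\overline\eta z)\rho_{n-2}^*(z)$$ is a monic $\tau$-invariant $(n,3)$-QPOPUC all of whose $n$ zeros are simple and lie on $\mathbb T$, with $\alpha_1$ and $\alpha_2$ among them. It is unique: it is the only monic $\tau$-invariant $(n,3)$-QPOPUC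 that vanishes at $\alpha_1$ and $\alpha_2$, and $\eta$ is the only complex number for which the polynomial of the above form vanishes at $\alpha_1$ and $\alpha_2$. -/

import Mathlib

open MeasureTheory Polynomial

noncomputable section

namespace UnitCircle

/-- A measure of the kind considered here: a finite positive Borel measure on the unit circle
(as a measure on `ℂ` for which the complement of the circle is a null set) whose support is an
infinite set, for example the whole circle or an arc with two distinct end points. -/
structure IsCircleMeasure (μ : Measure ℂ) : Prop where
  finite : IsFiniteMeasure μ
  circle : μ (Metric.sphere (0 : ℂ) 1)ᶜ = 0
  infinite_support : μ.support.Infinite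

/-- The inner product `⟨p, q⟩ = ∫ p(z) conj (q(z)) dμ(z)` of two polynomials. -/
def ip (μ : Measure ℂ) (p q : ℂ[X]) : ℂ :=
  ∫ z, p.eval z * (starRingEnd ℂ) (q.eval z) ∂μ

/-- The monic orthogonal polynomials (Szegő polynomials) `ρ 0, ρ 1, …` of `μ`, by the
Gram–Schmidt process applied to `1, z, z², …`. -/
def rho (μ : Measure ℂ) (n : ℕ) : ℂ[X] :=
  X ^ n - ∑ k : Fin n,
    C (ip μ (X ^ n) (rho μ k) / ip μ (rho μ k) (rho μ k)) * rho μ k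
termination_by n
decreasing_by all_goals exact k.2

theorem IsCircleMeasure.integrable {μ : Measure ℂ} (hμ : IsCircleMeasure μ) (p q : ℂ[X]) :
    Integrable (fun z => p.eval z * (starRingEnd ℂ) (q.eval z)) μ := by
  have := hμ.finite
  have h1 : μ.restrict (Metric.sphere (0 : ℂ) 1) = μ :=
    Measure.restrict_eq_self_of_ae_mem (mem_ae_iff.2 hμ.circle)
  rw [← h1]
  apply ContinuousOn.integrableOn_compact (isCompact_sphere 0 1)
  exact (p.continuous.mul (Complex.continuous_conj.comp q.continuous)).continuousOn

theorem IsCircleMeasure.ip_self_ne_zero {μ : Measure ℂ} (hμ : IsCircleMeasure μ) {p : ℂ[X]}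
    (hp : p ≠ 0) : ip μ p p ≠ 0 := by
  intro h
  have h1 : ip μ p p = ((∫ z, ‖p.eval z‖ ^ 2 ∂μ : ℝ) : ℂ) := by
    rw [ip, ← integral_complex_ofReal]
    congr 1
    ext z
    rw [Complex.mul_conj']
    push_cast
    rfl
  have h2 : Integrable (fun z => ‖p.eval z‖ ^ 2) μ := by
    have := (hμ.integrable p p).norm
    refine this.congr (Filter.Eventually.of_forall fun z => ?_)
    simp [sq]
  rw [h1, Complex.ofReal_eq_zero,
    integral_eq_zero_iff_of_nonneg (fun z => by positivity) h2] at h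
  refine hμ.infinite_support (Set.Finite.subset (p.finite_setOfPred_isRoot hp)
    (Measure.support_subset_of_isClosed
      (p.finite_setOfPred_isRoot hp).isClosed ?_))
  filter_upwards [h] with z hz
  simpa using hz

theorem IsCircleMeasure.ip_sub {μ : Measure ℂ} (hμ : IsCircleMeasure μ) (p q r : ℂ[X]) :
    ip μ (p - q) r = ip μ p r - ip μ q r := by
  simp only [ip]
  rw [← integral_sub (hμ.integrable p r) (hμ.integrable q r)]
  congr 1
  ext z
  simp [sub_mul]

theorem IsCircleMeasure.ip_sum {μ : Measure ℂ} (hμ : IsCircleMeasure μ) {ι : Type*}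
    (s : Finset ι) (c : ι → ℂ) (p : ι → ℂ[X]) (r : ℂ[X]) :
    ip μ (∑ i ∈ s, C (c i) * p i) r = ∑ i ∈ s, c i * ip μ (p i) r := by
  simp only [ip, ← integral_const_mul]
  rw [← integral_finsetSum s fun i _ => (hμ.integrable (p i) r).const_mul (c i)]
  congr 1
  ext z
  simp [eval_finsetSum, Finset.sum_mul, mul_assoc]

theorem ip_conj (μ : Measure ℂ) (p q : ℂ[X]) :
    (starRingEnd ℂ) (ip μ p q) = ip μ q p := by
  simp only [ip]
  rw [← integral_conj]
  congr 1
  ext z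
  simp [mul_comm]

/-- `ρ n` is monic of degree `n`. -/
theorem rho_monic_natDegree (μ : Measure ℂ) (n : ℕ) :
    (rho μ n).Monic ∧ (rho μ n).natDegree = n := by
  induction n using Nat.strong_induction_on with
  | _ n ih =>
    have hlt : (∑ k : Fin n,
        C (ip μ (X ^ n) (rho μ k) / ip μ (rho μ k) (rho μ k)) * rho μ k).degree <
          ((X : ℂ[X]) ^ n).degree := by
      rw [degree_X_pow]
      refine mem_degreeLT.1 (Submodule.sum_mem _ fun k _ => mem_degreeLT.2 ?_)
      rw [← smul_eq_C_mul]
      refine lt_of_le_of_lt (degree_smul_le _ _) ?_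
      rw [degree_eq_natDegree (ih k k.2).1.ne_zero, (ih k k.2).2]
      exact_mod_cast k.2
    rw [rho]
    refine ⟨(monic_X_pow n).sub_of_left hlt, ?_⟩
    exact natDegree_eq_of_degree_eq_some ((degree_sub_eq_left_of_degree_lt hlt).trans (degree_X_pow n))

/-- Distinct `ρ m`, `ρ n` are orthogonal. -/
theorem rho_orthogonal {μ : Measure ℂ} (hμ : IsCircleMeasure μ) (n : ℕ) :
    ∀ m < n, ip μ (rho μ n) (rho μ m) = 0 := by
  induction n using Nat.strong_induction_on with
  | _ n ih =>
    intro m hm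
    rw [rho, hμ.ip_sub, hμ.ip_sum, Finset.sum_eq_single (⟨m, hm⟩ : Fin n)]
    · rw [div_mul_cancel₀ _ (hμ.ip_self_ne_zero (rho_monic_natDegree μ m).1.ne_zero), sub_self]
    · intro k _ hk
      rcases lt_trichotomy (k : ℕ) m with h | h | h
      · rw [← ip_conj μ (rho μ m) (rho μ k), ih m hm k h, map_zero, mul_zero]
      · exact absurd (Fin.ext h) hk
      · rw [ih k k.2 m h, mul_zero]
    · intro h
      exact absurd (Finset.mem_univ _) h

/-- The reciprocal `P*(z) = z ^ n * conj (P (1 / conj z))` of a polynomial `P` of degree at most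
`n`: the coefficient of `z ^ k` in it is the conjugate of that of `z ^ (n - k)` in `P`. -/
def reciprocal (n : ℕ) (P : ℂ[X]) : ℂ[X] :=
  (P.map (starRingEnd ℂ)).reflect n

/-- The Blaschke product `F n = z ρ_{n-1}(z) / ρ_{n-1}*(z)` of degree `n ≥ 1`. -/
def blaschke (μ : Measure ℂ) (n : ℕ) (z : ℂ) : ℂ :=
  z * (rho μ (n - 1)).eval z / (reciprocal (n - 1) (rho μ (n - 1))).eval z

/-- `P` is a quasi-paraorthogonal polynomial of degree `n` and order `2 * l + 1` for `μ`, with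
invariance parameter `τ`: it has degree `n`, it is `τ`-invariant, and it is orthogonal to
`z ^ k` for `l + 1 ≤ k ≤ n - l - 1`. -/
structure IsQPOPUC (μ : Measure ℂ) (n l : ℕ) (τ : ℂ) (P : ℂ[X]) : Prop where
  degree_eq : P.degree = n
  norm_eq_one : ‖τ‖ = 1
  invariant : P = C τ * reciprocal n P
  orthogonal : ∀ k : ℕ, l + 1 ≤ k → k + l + 1 ≤ n → ip μ P (X ^ k) = 0

/-- The polynomial `z (z - η) ρ_{n-2}(z) + τ (1 - conj η z) ρ_{n-2}*(z)`, for `n ≥ 2`. -/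
def Q3 (μ : Measure ℂ) (n : ℕ) (τ : ℂ) (η : ℂ) : ℂ[X] :=
  X * (X - C η) * rho μ (n - 2) +
    C τ * (1 - C ((starRingEnd ℂ) η) * X) * reciprocal (n - 2) (rho μ (n - 2))

/-- `P` has degree `n`, all its zeros are simple and lie on the unit circle, and there are `n`
of them. -/
structure HasSimpleZerosOnCircle (n : ℕ) (P : ℂ[X]) : Prop where
  degree_eq : P.degree = n
  norm_eq_one : ∀ z : ℂ, P.IsRoot z → ‖z‖ = 1
  simple : ∀ z : ℂ, P.IsRoot z → P.rootMultiplicity z = 1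
  card : {z : ℂ | P.IsRoot z}.ncard = n

/-- `a`, `b`, `c` are distinct points of the unit circle which are met in this order when one
runs counterclockwise from `a` through `b` to `c`. -/
def CCW (a b c : ℂ) : Prop :=
  ∃ r s t : ℝ, r < s ∧ s < t ∧ t < r + 2 * Real.pi ∧
    a = Complex.exp (r * Complex.I) ∧ b = Complex.exp (s * Complex.I) ∧
      c = Complex.exp (t * Complex.I)

/-- The arcs `(a, b, c)` (from `a` over `b` to `c`) and `(a', b', c')` are well defined and have
opposite orientation: one runs counterclockwise and the other clockwise. An arc `(a, b, c)` is
clockwise when its reverse `(c, b, a)` is counterclockwise. -/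
def OppositeOrientation (a b c a' b' c' : ℂ) : Prop :=
  (CCW a b c ∧ CCW c' b' a') ∨ (CCW c b a ∧ CCW a' b' c')

/-- The open arc of the unit circle which runs from `a` over `b` to `c`, counterclockwise or
clockwise as the position of `b` requires. -/
def arc (a b c : ℂ) : Set ℂ :=
  {z | (CCW a b c ∧ CCW a z c) ∨ (CCW c b a ∧ CCW c z a)}

end UnitCircle

end

noncomputable section

namespace UnitCircle

open ComplexConjugate

/-! Write `n = N + 2` and `H = z(z - η)ρ_N`. Then `Q3 = H + τ H*`, which is monic and `τ`-invariant
and has the required orthogonality for every `η`.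

At a point `α` of the circle, dividing by `ρ_N*` and multiplying by `f = conj (F α)` turns `Q3 α =
0` into `α + τ f = η + α (τ f) conj η`. For `α ≠ τ f` this is the equation of the line through `α`
and `τ f`, evaluated at `η`. So the zeros `α₁`, `α₂` make `η` the intersection of the lines `α₁, τ
f₁` and `α₂, τ f₂`, which gives the formula for `η` and its uniqueness (`parameter_iff`). The
intersection is in the open disc when the chords cross, that is, when `α₂` and `τ f₂` lie on
opposite sides of the first chord. This is the condition on orientations
(`one_sub_norm_sq_of_chords`). As functions of `τ`, both this condition and membership in the arc
are governed by the sign of one real number, `(τ - p)(τ - q) / (τ m)`, where `p`, `q` are the ends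
of the arc and `m ^ 2 = p q` (`oppositeOrientation_iff_mem_arc`).

Once `‖η‖ < 1`, all zeros of `H` are in the disc, so `H / H*` is a finite Blaschke product. It has
modulus `1` only on the circle, and its argument strictly increases there, so it takes the value
`-τ` only at simple points of the circle (`hasSimpleZerosOnCircle`).

For uniqueness of the polynomial, orthogonality confines a monic candidate to `z²ρ_N + x zρ_N +
τρ_N* + y zρ_N*`, and invariance ties `y` to `x`, so the candidate is some `Q3` (`exists_eq_Q3`). -/

/-! ### Orientation of triples on the circle as the sign of an area -/

/-- Twice the signed area of the triangle `a b c`. -/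
def orient (a b c : ℂ) : ℝ := (conj (b - a) * (c - a)).im

theorem orient_reverse (a b c : ℂ) : orient c b a = -orient a b c := by
  simp only [orient, map_sub, Complex.mul_im, Complex.sub_re, Complex.sub_im, Complex.conj_re,
    Complex.conj_im]
  ring

theorem conj_eq_inv {a : ℂ} (ha : ‖a‖ = 1) : conj a = a⁻¹ :=
  (Complex.inv_eq_conj ha).symm

theorem ne_zero_of_norm_eq_one {a : ℂ} (ha : ‖a‖ = 1) : a ≠ 0 := by
  rintro rfl
  simp at ha

theorem orient_exp (r s t : ℝ) :
    orient (Complex.exp (r * Complex.I)) (Complex.exp (s * Complex.I))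
      (Complex.exp (t * Complex.I)) =
      4 * Real.sin ((s - r) / 2) * Real.sin ((t - s) / 2) * Real.sin ((t - r) / 2) := by
  -- Half-angles as variables leave a polynomial identity in the sines and cosines of `r`, `x`, `y`.
  obtain ⟨x, rfl⟩ : ∃ x, s = r + 2 * x := ⟨(s - r) / 2, by ring⟩
  obtain ⟨y, rfl⟩ : ∃ y, t = r + 2 * x + 2 * y := ⟨(t - (r + 2 * x)) / 2, by ring⟩
  have e1 : (r + 2 * x - r) / 2 = x := by ring
  have e2 : (r + 2 * x + 2 * y - (r + 2 * x)) / 2 = y := by ring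
  have e3 : (r + 2 * x + 2 * y - r) / 2 = x + y := by ring
  have e4 : r + 2 * x + 2 * y = r + (2 * (x + y)) := by ring
  rw [e1, e2, e3, e4]
  simp only [orient, map_sub, Complex.mul_im, Complex.sub_re, Complex.sub_im, Complex.conj_re,
    Complex.conj_im, Complex.exp_ofReal_mul_I_re, Complex.exp_ofReal_mul_I_im]
  simp only [Real.cos_add r, Real.sin_add r, Real.cos_two_mul, Real.sin_two_mul, Real.cos_add x,
    Real.sin_add x]
  have hr := Real.sin_sq_add_cos_sq r
  have hx := Real.sin_sq_add_cos_sq x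
  have hy := Real.sin_sq_add_cos_sq y
  generalize Real.sin r = a at *
  generalize Real.cos r = b at *
  generalize Real.sin x = c at *
  generalize Real.cos x = d at *
  generalize Real.sin y = e at *
  generalize Real.cos y = f at *
  grind

theorem exists_angle {a : ℂ} (ha : ‖a‖ = 1) (r : ℝ) :
    ∃ s : ℝ, r ≤ s ∧ s < r + 2 * Real.pi ∧ a = Complex.exp (s * Complex.I) := by
  have h := toIcoMod_mem_Ico Real.two_pi_pos r a.arg
  refine ⟨_, h.1, h.2, ?_⟩
  rw [toIcoMod]
  have : ((a.arg - toIcoDiv Real.two_pi_pos r a.arg • (2 * Real.pi) : ℝ) : ℂ) * Complex.I =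
      a.arg * Complex.I - (toIcoDiv Real.two_pi_pos r a.arg : ℤ) * (2 * Real.pi * Complex.I) := by
    push_cast [zsmul_eq_mul]
    ring
  rw [this, Complex.exp_periodic.sub_int_mul_eq]
  have := Complex.norm_mul_exp_arg_mul_I a
  rw [ha, Complex.ofReal_one, one_mul] at this
  exact this.symm

theorem orient_pos_of_ccw {a b c : ℂ} (h : CCW a b c) : 0 < orient a b c := by
  obtain ⟨r, s, t, hrs, hst, htr, rfl, rfl, rfl⟩ := h
  rw [orient_exp]
  have h1 := Real.sin_pos_of_pos_of_lt_pi (x := (s - r) / 2) (by linarith) (by linarith)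
  have h2 := Real.sin_pos_of_pos_of_lt_pi (x := (t - s) / 2) (by linarith) (by linarith)
  have h3 := Real.sin_pos_of_pos_of_lt_pi (x := (t - r) / 2) (by linarith) (by linarith)
  positivity

/-- Turns orientation into algebra: with angles chosen in one turn starting at `a`, the area is a
product of three sines of half-differences, and its sign records the order of `b` and `c`. -/
theorem ccw_iff {a b c : ℂ} (ha : ‖a‖ = 1) (hb : ‖b‖ = 1) (hc : ‖c‖ = 1) :
    CCW a b c ↔ 0 < orient a b c := by
  refine ⟨orient_pos_of_ccw, fun h => ?_⟩
  obtain ⟨r, -, -, rfl⟩ := exists_angle ha 0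
  obtain ⟨s, hs, hs', rfl⟩ := exists_angle hb r
  obtain ⟨t, ht, ht', rfl⟩ := exists_angle hc r
  rcases lt_trichotomy s t with hst | rfl | hst
  · rcases hs.eq_or_lt with rfl | hs
    · simp [orient] at h
    · exact ⟨r, s, t, hs, hst, ht', rfl, rfl, rfl⟩
  · rw [orient_exp] at h
    simp at h
  · rcases ht.eq_or_lt with rfl | ht
    · simp [orient] at h
    · have := orient_pos_of_ccw ⟨r, t, s, ht, hst, hs', rfl, rfl, rfl⟩
      rw [orient_exp] at h this
      rw [show (s - t) / 2 = -((t - s) / 2) by ring, Real.sin_neg] at this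
      linarith

theorem oppositeOrientation_iff {a b c d : ℂ} (ha : ‖a‖ = 1) (hb : ‖b‖ = 1) (hc : ‖c‖ = 1)
    (hd : ‖d‖ = 1) :
    OppositeOrientation a b c a b d ↔ orient a b c * orient a b d < 0 := by
  rw [OppositeOrientation, ccw_iff ha hb hc, ccw_iff hd hb ha, ccw_iff hc hb ha, ccw_iff ha hb hd,
    orient_reverse a b d, orient_reverse a b c, mul_neg_iff, neg_pos, neg_pos]

theorem mem_arc_iff {a b c z : ℂ} (ha : ‖a‖ = 1) (hb : ‖b‖ = 1) (hc : ‖c‖ = 1) (hz : ‖z‖ = 1) :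
    z ∈ arc a b c ↔ 0 < orient a b c * orient a z c := by
  rw [arc, Set.mem_ofPred_eq, ccw_iff ha hb hc, ccw_iff ha hz hc, ccw_iff hc hb ha,
    ccw_iff hc hz ha, orient_reverse a b c, orient_reverse a z c, mul_pos_iff, neg_pos, neg_pos]

/-- On the circle the signed area is a product of the differences of the points. -/
theorem ofReal_orient {a b c : ℂ} (ha : ‖a‖ = 1) (hb : ‖b‖ = 1) (hc : ‖c‖ = 1) :
    (orient a b c : ℂ) =
      Complex.I / 2 * ((a - b) * (b - c) * (c - a) / (a * b * c)) := by
  have ha0 := ne_zero_of_norm_eq_one ha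
  have hb0 := ne_zero_of_norm_eq_one hb
  have hc0 := ne_zero_of_norm_eq_one hc
  rw [orient, Complex.im_eq_sub_conj]
  simp only [map_mul, map_sub, Complex.conj_conj]
  simp only [conj_eq_inv ha, conj_eq_inv hb, conj_eq_inv hc]
  have hI := Complex.I_sq
  field_simp
  rw [hI]
  ring

theorem ofReal_norm_sub_sq {a b : ℂ} (ha : ‖a‖ = 1) (hb : ‖b‖ = 1) :
    ((‖a - b‖ ^ 2 : ℝ) : ℂ) = -(a - b) ^ 2 / (a * b) := by
  have ha0 := ne_zero_of_norm_eq_one ha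
  have hb0 := ne_zero_of_norm_eq_one hb
  rw [Complex.ofReal_pow, ← Complex.mul_conj', map_sub, conj_eq_inv ha, conj_eq_inv hb]
  field_simp
  ring

/-- The shared side contributes a squared length, so the sign rests on the four other differences.
-/
theorem orient_mul_orient {a b c d : ℂ} (ha : ‖a‖ = 1) (hb : ‖b‖ = 1) (hc : ‖c‖ = 1)
    (hd : ‖d‖ = 1) :
    ((orient a b c * orient a b d : ℝ) : ℂ) =
      (‖a - b‖ ^ 2 : ℝ) * ((b - c) * (c - a) * (b - d) * (d - a)) / (4 * (a * b * c * d)) := by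
  have ha0 := ne_zero_of_norm_eq_one ha
  have hb0 := ne_zero_of_norm_eq_one hb
  have hc0 := ne_zero_of_norm_eq_one hc
  have hd0 := ne_zero_of_norm_eq_one hd
  rw [Complex.ofReal_mul, ofReal_orient ha hb hc, ofReal_orient ha hb hd, ofReal_norm_sub_sq ha hb]
  have hI := Complex.I_sq
  field_simp
  rw [hI]
  ring

/-- The point in which the lines `a b` and `c d` meet is in the disc exactly when the chords
cross. -/
theorem one_sub_norm_sq_of_chords {a b c d η : ℂ} (ha : ‖a‖ = 1) (hb : ‖b‖ = 1) (hc : ‖c‖ = 1)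
    (hd : ‖d‖ = 1) (h : a * b ≠ c * d) (hη : conj η = (a + b - c - d) / (a * b - c * d)) :
    (1 - ‖η‖ ^ 2) * (‖a * b - c * d‖ ^ 2 * ‖a - b‖ ^ 2) = -4 * (orient a b c * orient a b d) := by
  have ha0 := ne_zero_of_norm_eq_one ha
  have hb0 := ne_zero_of_norm_eq_one hb
  have hc0 := ne_zero_of_norm_eq_one hc
  have hd0 := ne_zero_of_norm_eq_one hd
  have h0 : a * b - c * d ≠ 0 := sub_ne_zero.2 h
  -- On the circle `conj a = a⁻¹`, so `‖η‖ ^ 2` becomes a rational function of the four points.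
  have h1 : ((‖η‖ ^ 2 : ℝ) : ℂ) * (‖a * b - c * d‖ ^ 2 : ℝ) =
      (a + b - c - d) * (a⁻¹ + b⁻¹ - c⁻¹ - d⁻¹) := by
    have h2 : η * conj (a * b - c * d) = a⁻¹ + b⁻¹ - c⁻¹ - d⁻¹ := by
      rw [← conj_eq_inv ha, ← conj_eq_inv hb, ← conj_eq_inv hc, ← conj_eq_inv hd, ← map_add,
        ← map_sub, ← map_sub, ← div_mul_cancel₀ (a + b - c - d) h0, ← hη, map_mul,
        Complex.conj_conj]
    rw [Complex.ofReal_pow, Complex.ofReal_pow, ← Complex.mul_conj', ← Complex.mul_conj', hη, ← h2]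
    field_simp
  have hab : ‖a * b‖ = 1 := by rw [norm_mul, ha, hb, one_mul]
  have hcd : ‖c * d‖ = 1 := by rw [norm_mul, hc, hd, one_mul]
  have key : ((1 - (‖η‖ ^ 2 : ℝ) : ℂ)) * ((‖a * b - c * d‖ ^ 2 : ℝ) * (‖a - b‖ ^ 2 : ℝ)) =
      -4 * ((orient a b c * orient a b d : ℝ) : ℂ) := by
    rw [orient_mul_orient ha hb hc hd, ← mul_assoc, sub_mul, h1, ofReal_norm_sub_sq hab hcd,
      ofReal_norm_sub_sq ha hb]
    field_simp
    ring
  exact_mod_cast key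

/-! ### The parameter `η` and the two conditions on `τ` -/

section Arc

variable {α₁ α₂ f₁ f₂ τ : ℂ}

/-- The midpoint of the open arc in which `τ` has to lie. -/
def arcMid (α₁ α₂ f₁ f₂ : ℂ) : ℂ :=
  -((conj f₁ - conj f₂) / (‖f₁ - f₂‖ : ℂ)) * ((α₁ - α₂) / (‖α₁ - α₂‖ : ℂ))

theorem norm_arcMid (hα : α₁ ≠ α₂) (hf : f₁ ≠ f₂) : ‖arcMid α₁ α₂ f₁ f₂‖ = 1 := by
  have h1 : ‖α₁ - α₂‖ ≠ 0 := norm_ne_zero_iff.2 (sub_ne_zero.2 hα)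
  have h2 : ‖f₁ - f₂‖ ≠ 0 := norm_ne_zero_iff.2 (sub_ne_zero.2 hf)
  rw [arcMid, ← map_sub, norm_mul, norm_neg, norm_div, norm_div, RCLike.norm_conj,
    Complex.norm_real, Complex.norm_real, norm_norm, norm_norm, div_self h1, div_self h2, one_mul]

theorem arcMid_mul (hα : α₁ ≠ α₂) (hf : f₁ ≠ f₂) :
    arcMid α₁ α₂ f₁ f₂ * ((‖f₁ - f₂‖ * ‖α₁ - α₂‖ : ℝ) : ℂ) =
      -(conj f₁ - conj f₂) * (α₁ - α₂) := by
  have h1 : (‖α₁ - α₂‖ : ℂ) ≠ 0 := by simpa using sub_ne_zero.2 hα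
  have h2 : (‖f₁ - f₂‖ : ℂ) ≠ 0 := by simpa using sub_ne_zero.2 hf
  rw [arcMid]
  push_cast
  field_simp

/-- Since `‖a - b‖ ^ 2 = -(a - b) ^ 2 / (a b)` on the circle, the squared unit direction of a chord
is minus the product of its ends. The two signs cancel, and `arcMid` is a square root of the product
of the end points of the arc. -/
theorem arcMid_sq (h₁ : ‖α₁‖ = 1) (h₂ : ‖α₂‖ = 1) (hf₁ : ‖f₁‖ = 1) (hf₂ : ‖f₂‖ = 1)
    (hα : α₁ ≠ α₂) (hf : f₁ ≠ f₂) :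
    arcMid α₁ α₂ f₁ f₂ ^ 2 = α₁ * conj f₂ * (α₂ * conj f₁) := by
  have h3 : ((‖f₁ - f₂‖ * ‖α₁ - α₂‖ : ℝ) : ℂ) ≠ 0 := by
    simpa using ⟨sub_ne_zero.2 hf, sub_ne_zero.2 hα⟩
  refine mul_right_cancel₀ (pow_ne_zero 2 h3) ?_
  rw [← mul_pow, arcMid_mul hα hf, ← Complex.ofReal_pow, mul_pow ‖f₁ - f₂‖,
    Complex.ofReal_mul,
    ofReal_norm_sub_sq h₁ h₂, ofReal_norm_sub_sq hf₁ hf₂, conj_eq_inv hf₁, conj_eq_inv hf₂]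
  have := ne_zero_of_norm_eq_one h₁
  have := ne_zero_of_norm_eq_one h₂
  have := ne_zero_of_norm_eq_one hf₁
  have := ne_zero_of_norm_eq_one hf₂
  field_simp
  ring

/-- The crossing of the chords expressed through the quotient that also decides membership in the
arc; the factor in front is real and nonpositive. -/
theorem orient_mul_orient_chords (hτ : ‖τ‖ = 1) (h₁ : ‖α₁‖ = 1) (h₂ : ‖α₂‖ = 1) (hf₁ : ‖f₁‖ = 1)
    (hf₂ : ‖f₂‖ = 1) (hα : α₁ ≠ α₂) (hf : f₁ ≠ f₂) :
    ((orient α₁ (τ * f₁) α₂ * orient α₁ (τ * f₁) (τ * f₂) : ℝ) : ℂ) =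
      -((‖α₁ - τ * f₁‖ ^ 2 : ℝ) : ℂ) * ((‖f₁ - f₂‖ * ‖α₁ - α₂‖ : ℝ) : ℂ) / 4 *
        ((τ - α₁ * conj f₂) * (τ - α₂ * conj f₁) / (τ * arcMid α₁ α₂ f₁ f₂)) := by
  have hm := arcMid_sq h₁ h₂ hf₁ hf₂ hα hf
  have hm' := arcMid_mul hα hf
  have hm0 := ne_zero_of_norm_eq_one (norm_arcMid hα hf)
  have := ne_zero_of_norm_eq_one h₁
  have := ne_zero_of_norm_eq_one h₂
  have := ne_zero_of_norm_eq_one hf₁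
  have := ne_zero_of_norm_eq_one hf₂
  have := ne_zero_of_norm_eq_one hτ
  rw [orient_mul_orient h₁ (by simp [hτ, hf₁]) h₂ (by simp [hτ, hf₂])]
  generalize arcMid α₁ α₂ f₁ f₂ = m at *
  generalize ((‖α₁ - τ * f₁‖ ^ 2 : ℝ) : ℂ) = u
  generalize ((‖f₁ - f₂‖ * ‖α₁ - α₂‖ : ℝ) : ℂ) = v at *
  rw [conj_eq_inv hf₁, conj_eq_inv hf₂] at *
  have h (x : ℂ) : -u * v / 4 * (x / (τ * m)) = -u * x * (m * v) / (4 * τ * m ^ 2) := by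
    field_simp
  rw [h, hm, hm']
  field_simp
  ring

/-- From `m ^ 2 = p q` one gets `m - q = m (p - m) / p`, so the factors with `m` combine to a
squared length over a unit. -/
theorem orient_mul_orient_mid {p m q : ℂ} (hτ : ‖τ‖ = 1) (hp : ‖p‖ = 1) (hm : ‖m‖ = 1)
    (hq : ‖q‖ = 1) (h : m ^ 2 = p * q) :
    ((orient p m q * orient p τ q : ℝ) : ℂ) =
      ((‖q - p‖ ^ 2 * ‖p - m‖ ^ 2 / 4 : ℝ) : ℂ) * ((τ - p) * (τ - q) / (τ * m)) := by
  have hp0 := ne_zero_of_norm_eq_one hp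
  have hm0 := ne_zero_of_norm_eq_one hm
  have hτ0 := ne_zero_of_norm_eq_one hτ
  have e : ((‖q - p‖ ^ 2 * ‖p - m‖ ^ 2 / 4 : ℝ) : ℂ) =
      ((‖q - p‖ ^ 2 : ℝ) : ℂ) * ((‖p - m‖ ^ 2 : ℝ) : ℂ) / 4 := by
    push_cast
    rfl
  rw [e, ofReal_norm_sub_sq hq hp, ofReal_norm_sub_sq hp hm, Complex.ofReal_mul,
    ofReal_orient hp hm hq, ofReal_orient hp hτ hq]
  obtain rfl : q = m ^ 2 / p := by
    rw [h]
    field_simp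
  have hI := Complex.I_sq
  field_simp
  rw [hI]
  ring

theorem oppositeOrientation_iff_mem_arc (hτ : ‖τ‖ = 1) (h₁ : ‖α₁‖ = 1) (h₂ : ‖α₂‖ = 1)
    (hf₁ : ‖f₁‖ = 1) (hf₂ : ‖f₂‖ = 1) (hα : α₁ ≠ α₂) (hf : f₁ ≠ f₂) (hαf : α₁ * f₁ ≠ α₂ * f₂) :
    OppositeOrientation α₁ (τ * f₁) α₂ α₁ (τ * f₁) (τ * f₂) ↔
      τ ∈ arc (α₁ * conj f₂) (arcMid α₁ α₂ f₁ f₂) (α₂ * conj f₁) := by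
  have hm := arcMid_sq h₁ h₂ hf₁ hf₂ hα hf
  have hm' := arcMid_mul hα hf
  have hm1 := norm_arcMid hα hf
  have hp : ‖α₁ * conj f₂‖ = 1 := by simp [h₁, hf₂]
  have hq : ‖α₂ * conj f₁‖ = 1 := by simp [h₂, hf₁]
  have hA := orient_mul_orient_chords hτ h₁ h₂ hf₁ hf₂ hα hf
  have hB := orient_mul_orient_mid hτ hp hm1 hq hm
  rw [oppositeOrientation_iff h₁ (by simp [hτ, hf₁]) h₂ (by simp [hτ, hf₂]),
    mem_arc_iff hp hm1 hq hτ]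
  have hf₁0 := ne_zero_of_norm_eq_one hf₁
  have hf₂0 := ne_zero_of_norm_eq_one hf₂
  have hτ0 := ne_zero_of_norm_eq_one hτ
  have hm0 := ne_zero_of_norm_eq_one hm1
  have hpq : α₁ * conj f₂ ≠ α₂ * conj f₁ := by
    intro h
    rw [conj_eq_inv hf₁, conj_eq_inv hf₂] at h
    field_simp at h
    exact hαf (h.trans (mul_comm _ _))
  have hpm : α₁ * conj f₂ ≠ arcMid α₁ α₂ f₁ f₂ := by
    intro h
    rw [← h, sq] at hm
    exact hpq (mul_left_cancel₀ (ne_zero_of_norm_eq_one hp) hm)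
  have hk : 0 < ‖α₂ * conj f₁ - α₁ * conj f₂‖ ^ 2 *
      ‖α₁ * conj f₂ - arcMid α₁ α₂ f₁ f₂‖ ^ 2 / 4 := by
    have := norm_pos_iff.2 (sub_ne_zero.2 hpq.symm)
    have := norm_pos_iff.2 (sub_ne_zero.2 hpm)
    positivity
  have hl : 0 < ‖f₁ - f₂‖ * ‖α₁ - α₂‖ :=
    mul_pos (norm_pos_iff.2 (sub_ne_zero.2 hf)) (norm_pos_iff.2 (sub_ne_zero.2 hα))
  -- When the first chord degenerates, the areas vanish and carry no information; a direct
  -- computation shows that the quotient is then negative, so `τ` is not in the arc either.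
  have hdeg : ‖α₁ - τ * f₁‖ = 0 → (τ - α₁ * conj f₂) * (τ - α₂ * conj f₁) /
      (τ * arcMid α₁ α₂ f₁ f₂) = ((-(‖f₁ - f₂‖ * ‖α₁ - α₂‖) : ℝ) : ℂ) := by
    intro h
    rw [norm_eq_zero, sub_eq_zero] at h
    rw [div_eq_iff (mul_ne_zero hτ0 hm0), Complex.ofReal_neg, neg_mul, mul_left_comm,
      mul_comm _ (arcMid _ _ _ _), hm', conj_eq_inv hf₁, conj_eq_inv hf₂, h]
    field_simp
  generalize orient α₁ (τ * f₁) α₂ * orient α₁ (τ * f₁) (τ * f₂) = A at *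
  generalize orient (α₁ * conj f₂) (arcMid α₁ α₂ f₁ f₂) (α₂ * conj f₁) *
    orient (α₁ * conj f₂) τ (α₂ * conj f₁) = B at *
  generalize ‖α₂ * conj f₁ - α₁ * conj f₂‖ ^ 2 *
    ‖α₁ * conj f₂ - arcMid α₁ α₂ f₁ f₂‖ ^ 2 / 4 = k at *
  generalize ‖f₁ - f₂‖ * ‖α₁ - α₂‖ = l at *
  generalize (τ - α₁ * conj f₂) * (τ - α₂ * conj f₁) / (τ * arcMid α₁ α₂ f₁ f₂) = E at *
  have hn : 0 ≤ ‖α₁ - τ * f₁‖ := norm_nonneg _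
  generalize ‖α₁ - τ * f₁‖ = u at *
  -- The quotient is real because it is a real number divided by `k > 0`.
  obtain ⟨e, rfl⟩ : ∃ e : ℝ, (e : ℂ) = E := by
    refine ⟨B / k, ?_⟩
    rw [Complex.ofReal_div, hB, mul_div_cancel_left₀]
    exact_mod_cast hk.ne'
  have hA' : A = -u ^ 2 * l / 4 * e := by exact_mod_cast hA
  have hB' : B = k * e := by exact_mod_cast hB
  subst hA' hB'
  have hdeg' : u = 0 → e = -l := fun h => by exact_mod_cast hdeg h
  constructor
  · intro h
    by_contra! h'
    have he : e ≤ 0 := by nlinarith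
    have : 0 ≤ u ^ 2 * l := by positivity
    nlinarith
  · intro h
    have he : 0 < e := (pos_iff_pos_of_mul_pos h).1 hk
    have hu : 0 < u := hn.lt_of_ne fun h => by linarith [hdeg' h.symm]
    have : 0 < u ^ 2 * l * e := by positivity
    linarith

theorem norm_lt_one_of_oppositeOrientation {η : ℂ} (hτ : ‖τ‖ = 1) (h₁ : ‖α₁‖ = 1) (h₂ : ‖α₂‖ = 1)
    (hf₁ : ‖f₁‖ = 1) (hf₂ : ‖f₂‖ = 1) (hαf : α₁ * f₁ ≠ α₂ * f₂)
    (hη : τ * (f₁ * α₁ - f₂ * α₂) * conj η = α₁ - α₂ + τ * (f₁ - f₂))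
    (h : OppositeOrientation α₁ (τ * f₁) α₂ α₁ (τ * f₁) (τ * f₂)) : ‖η‖ < 1 := by
  have hb : ‖τ * f₁‖ = 1 := by simp [hτ, hf₁]
  have hd : ‖τ * f₂‖ = 1 := by simp [hτ, hf₂]
  rw [oppositeOrientation_iff h₁ hb h₂ hd] at h
  have hτ0 := ne_zero_of_norm_eq_one hτ
  have hne : α₁ * (τ * f₁) ≠ α₂ * (τ * f₂) := by
    rw [mul_left_comm, mul_left_comm α₂]
    exact fun h => hαf (mul_left_cancel₀ hτ0 h)
  have key := one_sub_norm_sq_of_chords (η := η) h₁ hb h₂ hd hne (by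
    rw [eq_div_iff (sub_ne_zero.2 hne)]
    linear_combination hη)
  by_contra! hc
  have : (1 - ‖η‖ ^ 2) * (‖α₁ * (τ * f₁) - α₂ * (τ * f₂)‖ ^ 2 * ‖α₁ - τ * f₁‖ ^ 2) ≤ 0 :=
    mul_nonpos_of_nonpos_of_nonneg (by nlinarith) (by positivity)
  linarith

/-- The two conditions that `Q3` vanishes at `α₁` and `α₂` determine its parameter. -/
theorem parameter_iff {η : ℂ} (hτ : ‖τ‖ = 1) (h₁ : ‖α₁‖ = 1) (h₂ : ‖α₂‖ = 1)
    (hf₁ : ‖f₁‖ = 1) (hf₂ : ‖f₂‖ = 1) (hαf : α₁ * f₁ ≠ α₂ * f₂) :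
    η = conj ((f₁ - f₂) / (f₁ * α₁ - f₂ * α₂)) + τ * conj ((α₁ - α₂) / (f₁ * α₁ - f₂ * α₂)) ↔
      (α₁ - η) + τ * f₁ * (1 - conj η * α₁) = 0 ∧ (α₂ - η) + τ * f₂ * (1 - conj η * α₂) = 0 := by
  have hτ0 := ne_zero_of_norm_eq_one hτ
  have h₁0 := ne_zero_of_norm_eq_one h₁
  have h₂0 := ne_zero_of_norm_eq_one h₂
  have hf₁0 := ne_zero_of_norm_eq_one hf₁
  have hf₂0 := ne_zero_of_norm_eq_one hf₂
  have hD : f₁ * α₁ - f₂ * α₂ ≠ 0 := by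
    rw [mul_comm f₁, mul_comm f₂]
    exact sub_ne_zero.2 hαf
  have hD' : f₂ * α₂ - f₁ * α₁ ≠ 0 := by
    rw [← neg_sub]
    exact neg_ne_zero.2 hD
  constructor
  · intro h
    have hc : conj η = (f₁ - f₂) / (f₁ * α₁ - f₂ * α₂) +
        τ⁻¹ * ((α₁ - α₂) / (f₁ * α₁ - f₂ * α₂)) := by
      rw [h, map_add, map_mul, Complex.conj_conj, Complex.conj_conj, conj_eq_inv hτ]
    have he : η = (α₁ * α₂ * (f₂ - f₁) + τ * (f₁ * f₂ * (α₂ - α₁))) / (f₂ * α₂ - f₁ * α₁) := by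
      simp only [map_div₀, map_sub, map_mul, conj_eq_inv h₁, conj_eq_inv h₂, conj_eq_inv hf₁,
        conj_eq_inv hf₂] at h
      have e : f₁⁻¹ * α₁⁻¹ - f₂⁻¹ * α₂⁻¹ = (f₂ * α₂ - f₁ * α₁) / (f₁ * f₂ * α₁ * α₂) := by
        field_simp
      rw [h, e]
      field_simp
    rw [hc, he]
    constructor
    · field_simp
      ring
    · field_simp
      ring
  · rintro ⟨e₁, e₂⟩
    -- Subtracting the two equations eliminates `η` and leaves a linear equation for `conj η`.
    have hc : conj η = (f₁ - f₂) / (f₁ * α₁ - f₂ * α₂) +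
        τ⁻¹ * ((α₁ - α₂) / (f₁ * α₁ - f₂ * α₂)) := by
      field_simp
      linear_combination e₂ - e₁
    rw [← Complex.conj_conj η, hc, map_add, map_mul, ← conj_eq_inv hτ, Complex.conj_conj]

end Arc

/-! ### Algebra of reciprocal polynomials -/

section Reciprocal

theorem coeff_reciprocal {n k : ℕ} (hk : k ≤ n) (P : ℂ[X]) :
    (reciprocal n P).coeff k = conj (P.coeff (n - k)) := by
  rw [reciprocal, coeff_reflect, revAt_le hk, coeff_map]

theorem reciprocal_add (n : ℕ) (P Q : ℂ[X]) :
    reciprocal n (P + Q) = reciprocal n P + reciprocal n Q := by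
  rw [reciprocal, Polynomial.map_add, reflect_add, reciprocal, reciprocal]

theorem reciprocal_C_mul (n : ℕ) (c : ℂ) (P : ℂ[X]) :
    reciprocal n (C c * P) = C (conj c) * reciprocal n P := by
  rw [reciprocal, Polynomial.map_mul, map_C, reflect_C_mul, reciprocal]

theorem reciprocal_reciprocal (n : ℕ) (P : ℂ[X]) : reciprocal n (reciprocal n P) = P := by
  rw [reciprocal, reciprocal, ← reflect_map, reflect_reflect, Polynomial.map_map]
  ext k
  simp

theorem reciprocal_mul {m n : ℕ} {P Q : ℂ[X]} (hP : P.natDegree ≤ m) (hQ : Q.natDegree ≤ n) :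
    reciprocal (m + n) (P * Q) = reciprocal m P * reciprocal n Q := by
  rw [reciprocal, Polynomial.map_mul, reflect_mul _ _ (natDegree_map_le.trans hP)
    (natDegree_map_le.trans hQ), reciprocal, reciprocal]

theorem natDegree_reciprocal_le {n : ℕ} {P : ℂ[X]} (hP : P.natDegree ≤ n) :
    (reciprocal n P).natDegree ≤ n :=
  natDegree_reflect_le.trans (max_le le_rfl (natDegree_map_le.trans hP))

theorem reciprocal_X_sub_C (w : ℂ) : reciprocal 1 (X - C w) = 1 - C (conj w) * X := by
  ext k
  rcases Nat.lt_or_ge 1 k with hk | hk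
  · rw [coeff_eq_zero_of_natDegree_lt
      ((natDegree_reciprocal_le (natDegree_X_sub_C w).le).trans_lt hk)]
    simp [coeff_one, coeff_X, hk.ne, (zero_lt_one.trans hk).ne']
  · rw [coeff_reciprocal hk]
    interval_cases k <;> simp [coeff_one, coeff_X]

theorem reciprocal_one : reciprocal 0 1 = 1 := by
  rw [reciprocal, Polynomial.map_one, ← C_1, reflect_C, pow_zero, mul_one]

theorem eval_reciprocal {n : ℕ} {P : ℂ[X]} (hP : P.natDegree ≤ n) {z : ℂ} (hz : ‖z‖ = 1) :
    (reciprocal n P).eval z = z ^ n * conj (P.eval z) := by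
  have hz0 := ne_zero_of_norm_eq_one hz
  let _ : Invertible (conj z) :=
    ⟨z, by rw [conj_eq_inv hz, mul_inv_cancel₀ hz0], by rw [conj_eq_inv hz, inv_mul_cancel₀ hz0]⟩
  have h := eval₂_reflect_mul_pow (RingHom.id ℂ) (conj z) n (P.map (starRingEnd ℂ))
    (natDegree_map_le.trans hP)
  change eval z (reciprocal n P) * conj z ^ n = eval (conj z) (P.map (starRingEnd ℂ)) at h
  rw [eval_map_apply, conj_eq_inv hz] at h
  rw [← h, mul_left_comm, ← mul_pow, mul_inv_cancel₀ hz0, one_pow, mul_one]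

end Reciprocal

/-! ### Polynomials with all zeros in the disc -/

section ZerosInDisc

theorem norm_sq_one_sub_sub_norm_sq_sub (w z : ℂ) :
    ‖1 - conj w * z‖ ^ 2 - ‖z - w‖ ^ 2 = (1 - ‖z‖ ^ 2) * (1 - ‖w‖ ^ 2) := by
  simp only [← Complex.normSq_eq_norm_sq, Complex.normSq_apply, Complex.sub_re, Complex.sub_im,
    Complex.mul_re, Complex.mul_im, Complex.conj_re, Complex.conj_im, Complex.one_re,
    Complex.one_im]
  ring

/-- Induction on the number of zeros of a monic polynomial all of whose zeros are in the disc. -/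
theorem monic_disc_induction {motive : ℂ[X] → Prop} (one : motive 1)
    (mul : ∀ w P, ‖w‖ < 1 → P.Monic → motive P → motive ((X - C w) * P)) {P : ℂ[X]}
    (hP : P.Monic) (h : ∀ z, P.IsRoot z → ‖z‖ < 1) : motive P := by
  rw [(IsAlgClosed.splits P).eq_prod_roots_of_monic hP]
  have h' : ∀ z ∈ P.roots, ‖z‖ < 1 := fun z hz => h z (isRoot_of_mem_roots hz)
  generalize P.roots = s at h'
  induction s using Multiset.induction_on with
  | empty => simpa using one
  | cons w s ih =>
    rw [Multiset.map_cons, Multiset.prod_cons]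
    exact mul w _ (h' w (Multiset.mem_cons_self w s)) (monic_multiset_prod_of_monic _ _
      fun a _ => monic_X_sub_C a) (ih fun z hz => h' z (Multiset.mem_cons_of_mem hz))

theorem reciprocal_X_sub_C_mul (w : ℂ) {P : ℂ[X]} (hP : P.Monic) :
    reciprocal ((X - C w) * P).natDegree ((X - C w) * P) =
      (1 - C (conj w) * X) * reciprocal P.natDegree P := by
  rw [(monic_X_sub_C w).natDegree_mul hP, natDegree_X_sub_C,
    reciprocal_mul (natDegree_X_sub_C w).le le_rfl, reciprocal_X_sub_C]

theorem one_sub_conj_mul_ne_zero {w z : ℂ} (hw : ‖w‖ < 1) (hz : ‖z‖ ≤ 1) :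
    1 - conj w * z ≠ 0 := by
  intro h
  have h1 : ‖conj w * z‖ = 1 := by rw [← sub_eq_zero.1 h, norm_one]
  rw [norm_mul, RCLike.norm_conj] at h1
  nlinarith [norm_nonneg w, norm_nonneg z]

variable {P : ℂ[X]} {z : ℂ}

theorem eval_reciprocal_ne_zero (hP : P.Monic) (h : ∀ z, P.IsRoot z → ‖z‖ < 1) (hz : ‖z‖ ≤ 1) :
    (reciprocal P.natDegree P).eval z ≠ 0 := by
  refine monic_disc_induction (motive := fun P => (reciprocal P.natDegree P).eval z ≠ 0) ?_ ?_ hP h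
  · simp [reciprocal_one]
  · intro w P hw hP ih
    rw [reciprocal_X_sub_C_mul w hP, eval_mul]
    refine mul_ne_zero ?_ ih
    simpa using one_sub_conj_mul_ne_zero hw hz

/-- Each Blaschke factor `(z - w) / (1 - conj w z)` has modulus below `1` in the disc. The empty
product `P = 1` must be excepted because the inequality is strict. -/
theorem norm_eval_lt_norm_eval_reciprocal (hP : P.Monic) (h : ∀ z, P.IsRoot z → ‖z‖ < 1)
    (hz : ‖z‖ < 1) : P = 1 ∨ ‖P.eval z‖ < ‖(reciprocal P.natDegree P).eval z‖ := by
  refine monic_disc_induction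
    (motive := fun P => P = 1 ∨ ‖P.eval z‖ < ‖(reciprocal P.natDegree P).eval z‖) (.inl rfl) ?_ hP h
  intro w P hw hP ih
  right
  rw [reciprocal_X_sub_C_mul w hP, eval_mul, eval_mul, norm_mul, norm_mul]
  simp only [eval_sub, eval_X, eval_C, eval_one, eval_mul]
  have h1 : ‖z - w‖ < ‖1 - conj w * z‖ := by
    refine lt_of_pow_lt_pow_left₀ 2 (norm_nonneg _) (sub_pos.1 ?_)
    rw [norm_sq_one_sub_sub_norm_sq_sub]
    refine mul_pos ?_ ?_ <;> nlinarith [norm_nonneg w, norm_nonneg z]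
  rcases ih with rfl | ih
  · simpa [reciprocal_one] using h1
  · exact mul_lt_mul'' h1 ih (norm_nonneg _) (norm_nonneg _)

theorem norm_eval_reciprocal_lt_norm_eval (hP : P.Monic) (h : ∀ z, P.IsRoot z → ‖z‖ < 1)
    (hz : 1 < ‖z‖) : P = 1 ∨ ‖(reciprocal P.natDegree P).eval z‖ < ‖P.eval z‖ := by
  refine monic_disc_induction
    (motive := fun P => P = 1 ∨ ‖(reciprocal P.natDegree P).eval z‖ < ‖P.eval z‖) (.inl rfl) ?_ hP h
  intro w P hw hP ih
  right
  rw [reciprocal_X_sub_C_mul w hP, eval_mul, eval_mul, norm_mul, norm_mul]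
  simp only [eval_sub, eval_X, eval_C, eval_one, eval_mul]
  have h1 : ‖1 - conj w * z‖ < ‖z - w‖ := by
    refine lt_of_pow_lt_pow_left₀ 2 (norm_nonneg _) (sub_neg.1 ?_)
    rw [norm_sq_one_sub_sub_norm_sq_sub]
    refine mul_neg_of_neg_of_pos ?_ ?_ <;> nlinarith [norm_nonneg w, norm_nonneg z]
  rcases ih with rfl | ih
  · simpa [reciprocal_one] using h1
  · exact mul_lt_mul'' h1 ih (norm_nonneg _) (norm_nonneg _)

/-- The argument of `P / P*` increases along the circle. -/
theorem wronskian_reciprocal (hP : P.Monic) (h : ∀ z, P.IsRoot z → ‖z‖ < 1) (hz : ‖z‖ = 1) :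
    P = 1 ∨ ∃ c : ℝ, 0 < c ∧
      z * (P.derivative.eval z * (reciprocal P.natDegree P).eval z -
        P.eval z * (reciprocal P.natDegree P).derivative.eval z) =
          c * (P.eval z * (reciprocal P.natDegree P).eval z) := by
  refine monic_disc_induction
    (motive := fun P => P = 1 ∨ ∃ c : ℝ, 0 < c ∧
      z * (P.derivative.eval z * (reciprocal P.natDegree P).eval z -
        P.eval z * (reciprocal P.natDegree P).derivative.eval z) =
          c * (P.eval z * (reciprocal P.natDegree P).eval z)) (.inl rfl) ?_ hP h
  intro w P hw hP ih
  right
  rw [reciprocal_X_sub_C_mul w hP]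
  have hz0 := ne_zero_of_norm_eq_one hz
  have hzw : z - w ≠ 0 := by
    rw [sub_ne_zero]
    rintro rfl
    exact hw.ne hz
  -- The Poisson kernel: `z` times the logarithmic derivative of a single Blaschke factor at a point
  -- of the circle.
  have hd : 0 < (1 - ‖w‖ ^ 2) / ‖z - w‖ ^ 2 := by
    have := norm_pos_iff.2 hzw
    have : 0 < 1 - ‖w‖ ^ 2 := by nlinarith [norm_nonneg w]
    positivity
  have hd' : (((1 - ‖w‖ ^ 2) / ‖z - w‖ ^ 2 : ℝ) : ℂ) * ((z - w) * (1 - conj w * z)) =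
      z * (1 - conj w * w) := by
    have h1 : conj (z - w) ≠ 0 := (_root_.map_ne_zero _).2 hzw
    have h2 : 1 - conj w * z = z * conj (z - w) := by
      rw [map_sub, conj_eq_inv hz]
      field_simp
    push_cast
    rw [← Complex.mul_conj', ← Complex.mul_conj', h2]
    field_simp
  simp only [derivative_mul, derivative_sub, derivative_X, derivative_C, derivative_one, eval_add,
    eval_mul, eval_sub, eval_X, eval_C, eval_one, zero_mul, mul_one, sub_zero, one_mul,
    zero_add, zero_sub, eval_neg]
  rcases ih with rfl | ⟨c, hc, ih⟩
  · refine ⟨_, hd, ?_⟩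
    simp only [natDegree_one, reciprocal_one, eval_one, derivative_one, eval_zero]
    linear_combination -hd'
  · refine ⟨c + _, add_pos hc hd, ?_⟩
    push_cast at hd' ⊢
    linear_combination (z - w) * (1 - conj w * z) * ih -
      P.eval z * (reciprocal P.natDegree P).eval z * hd'

/-- The top coefficient of `P*` is `conj (P 0) = 0`, so adding `τ P*` does not disturb the leading
term. -/
theorem degree_add_C_mul_reciprocal (τ : ℂ) (hP : P.Monic) (h0 : P.coeff 0 = 0) :
    (P + C τ * reciprocal P.natDegree P).Monic ∧
      (P + C τ * reciprocal P.natDegree P).natDegree = P.natDegree := by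
  have hdeg : (C τ * reciprocal P.natDegree P).degree < P.degree := by
    rw [degree_eq_natDegree hP.ne_zero, degree_lt_iff_coeff_zero]
    intro m hm
    rcases hm.eq_or_lt with rfl | hm
    · rw [coeff_C_mul, coeff_reciprocal le_rfl, Nat.sub_self, h0, map_zero, mul_zero]
    · rw [coeff_C_mul, coeff_eq_zero_of_natDegree_lt
        ((natDegree_reciprocal_le le_rfl).trans_lt hm), mul_zero]
  exact ⟨hP.add_of_left hdeg, natDegree_add_eq_left_of_degree_lt hdeg⟩

/-- If all zeros of the monic polynomial `P` are in the disc and `P 0 = 0`, then the zeros of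
`P + τ P*` are simple and on the circle. -/
theorem hasSimpleZerosOnCircle {τ : ℂ} (hτ : ‖τ‖ = 1) (hP : P.Monic)
    (h : ∀ z, P.IsRoot z → ‖z‖ < 1) (h0 : P.coeff 0 = 0) :
    HasSimpleZerosOnCircle P.natDegree (P + C τ * reciprocal P.natDegree P) := by
  obtain ⟨hQ, hQn⟩ := degree_add_C_mul_reciprocal τ hP h0
  have hP1 : P ≠ 1 := by
    rintro rfl
    simp at h0
  have hnorm {z : ℂ} (hz : (P + C τ * reciprocal P.natDegree P).IsRoot z) :
      ‖P.eval z‖ = ‖(reciprocal P.natDegree P).eval z‖ := by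
    rw [IsRoot.def, eval_add, eval_mul, eval_C, add_eq_zero_iff_eq_neg] at hz
    rw [hz, norm_neg, norm_mul, hτ, one_mul]
  have hcirc : ∀ z, (P + C τ * reciprocal P.natDegree P).IsRoot z → ‖z‖ = 1 := by
    intro z hz
    rcases lt_trichotomy ‖z‖ 1 with h1 | h1 | h1
    · exact absurd (hnorm hz)
        ((norm_eval_lt_norm_eval_reciprocal hP h h1).resolve_left hP1).ne
    · exact h1
    · exact absurd (hnorm hz)
        ((norm_eval_reciprocal_lt_norm_eval hP h h1).resolve_left hP1).ne'
  have hsimple : ∀ z, (P + C τ * reciprocal P.natDegree P).IsRoot z →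
      (P + C τ * reciprocal P.natDegree P).rootMultiplicity z = 1 := by
    intro z hz
    refine le_antisymm (not_lt.1 fun hlt => ?_) ((rootMultiplicity_pos hQ.ne_zero).2 hz)
    have hd := ((one_lt_rootMultiplicity_iff_isRoot hQ.ne_zero).1 hlt).2
    have hz1 := hcirc z hz
    obtain ⟨c, hc, e⟩ := (wronskian_reciprocal hP h hz1).resolve_left hP1
    have h1 := eval_reciprocal_ne_zero hP h hz1.le
    have h2 : P.eval z ≠ 0 := fun h' => (h z h').ne hz1
    simp only [IsRoot.def, derivative_add, derivative_mul, derivative_C, eval_add, eval_mul,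
      eval_C, zero_mul, zero_add] at hz hd
    -- At a double zero `P = -τ P*` and `P' = -τ (P*)'`, so the Wronskian of `P` and `P*` would
    -- vanish.
    have : (c : ℂ) * (P.eval z * (reciprocal P.natDegree P).eval z) = 0 := by
      linear_combination -e + z * (reciprocal P.natDegree P).eval z * hd -
        z * (reciprocal P.natDegree P).derivative.eval z * hz
    exact mul_ne_zero (by exact_mod_cast hc.ne') (mul_ne_zero h2 h1) this
  refine ⟨by rw [degree_eq_natDegree hQ.ne_zero, hQn], hcirc, hsimple, ?_⟩
  have hnd : (P + C τ * reciprocal P.natDegree P).roots.Nodup := by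
    classical
    refine Multiset.nodup_iff_count_eq_one.2 fun z hz => ?_
    rw [count_roots]
    exact hsimple z (isRoot_of_mem_roots hz)
  have hset : {z : ℂ | (P + C τ * reciprocal P.natDegree P).IsRoot z} =
      (P + C τ * reciprocal P.natDegree P).roots.toFinset := by
    ext z
    simp only [Set.mem_ofPred_eq, Finset.mem_coe, Multiset.mem_toFinset, mem_roots hQ.ne_zero]
  rw [hset, Set.ncard_coe_finset, Multiset.toFinset_card_of_nodup hnd,
    ← (IsAlgClosed.splits _).natDegree_eq_card_roots, hQn]

end ZerosInDisc

/-! ### Orthogonality, zeros of `ρ n`, and the span of `ρ n` and its reciprocal -/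

section InnerProduct

variable {μ : Measure ℂ}

theorem ip_congr (hμ : IsCircleMeasure μ) {p q p' q' : ℂ[X]}
    (h : ∀ z : ℂ, ‖z‖ = 1 → p.eval z * conj (q.eval z) = p'.eval z * conj (q'.eval z)) :
    ip μ p q = ip μ p' q' := by
  refine integral_congr_ae ?_
  filter_upwards [mem_ae_iff.2 hμ.circle] with z hz
  exact h z (by simpa using hz)

theorem ip_add_left (hμ : IsCircleMeasure μ) (p q r : ℂ[X]) :
    ip μ (p + q) r = ip μ p r + ip μ q r := by
  rw [← add_sub_cancel_right p q, hμ.ip_sub]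
  simp

theorem ip_C_mul_left (c : ℂ) (p q : ℂ[X]) : ip μ (C c * p) q = c * ip μ p q := by
  simp only [ip, ← integral_const_mul, eval_mul, eval_C, mul_assoc]

theorem ip_add_right (hμ : IsCircleMeasure μ) (p q r : ℂ[X]) :
    ip μ p (q + r) = ip μ p q + ip μ p r := by
  rw [← ip_conj, ip_add_left hμ, map_add, ip_conj, ip_conj]

theorem ip_C_mul_right (c : ℂ) (p q : ℂ[X]) : ip μ p (C c * q) = conj c * ip μ p q := by
  rw [← ip_conj, ip_C_mul_left, map_mul, ip_conj]

theorem ip_X_mul (hμ : IsCircleMeasure μ) (p q : ℂ[X]) : ip μ (X * p) (X * q) = ip μ p q := by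
  refine ip_congr hμ fun z hz => ?_
  have hz0 := ne_zero_of_norm_eq_one hz
  simp only [eval_mul, eval_X, map_mul, conj_eq_inv hz]
  field_simp

theorem ip_eq_sum (hμ : IsCircleMeasure μ) (p q : ℂ[X]) :
    ip μ p q = ∑ k ∈ Finset.range (q.natDegree + 1), conj (q.coeff k) * ip μ p (X ^ k) := by
  conv_lhs => rw [q.as_sum_range_C_mul_X_pow, ← ip_conj, hμ.ip_sum, map_sum]
  simp only [map_mul, ip_conj]

theorem ip_self (hμ : IsCircleMeasure μ) {p : ℂ[X]} (hp : p ≠ 0) :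
    ∃ r : ℝ, 0 < r ∧ ip μ p p = r := by
  have h : ip μ p p = ((∫ z, ‖p.eval z‖ ^ 2 ∂μ : ℝ) : ℂ) := by
    rw [ip, ← integral_complex_ofReal]
    simp [Complex.mul_conj']
  refine ⟨_, lt_of_le_of_ne (integral_nonneg fun z => by positivity) fun h0 => ?_, h⟩
  exact hμ.ip_self_ne_zero hp (by rw [h, ← h0, Complex.ofReal_zero])

theorem ip_rho_X_pow (hμ : IsCircleMeasure μ) {m n : ℕ} (h : m < n) :
    ip μ (rho μ n) (X ^ m) = 0 := by
  have e : (X : ℂ[X]) ^ m = rho μ m + ∑ k : Fin m,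
      C (ip μ (X ^ m) (rho μ k) / ip μ (rho μ k) (rho μ k)) * rho μ k := by
    rw [rho, sub_add_cancel]
  rw [← ip_conj, e, ip_add_left hμ, hμ.ip_sum, ← ip_conj, rho_orthogonal hμ n m h, map_zero,
    zero_add, Finset.sum_eq_zero, map_zero]
  intro k _
  rw [← ip_conj μ (rho μ n), rho_orthogonal hμ n k (k.2.trans h), map_zero, mul_zero]

theorem ip_rho_of_natDegree_lt (hμ : IsCircleMeasure μ) {n : ℕ} {q : ℂ[X]} (h : q.natDegree < n) :
    ip μ (rho μ n) q = 0 := by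
  rw [ip_eq_sum hμ, Finset.sum_eq_zero]
  intro k hk
  rw [ip_rho_X_pow hμ ((Nat.lt_succ_iff.1 (Finset.mem_range.1 hk)).trans_lt h), mul_zero]

/-- The zeros of the orthogonal polynomials are in the open unit disc. -/
theorem norm_lt_one_of_isRoot_rho (hμ : IsCircleMeasure μ) {n : ℕ} {w : ℂ}
    (hw : (rho μ n).IsRoot w) : ‖w‖ < 1 := by
  obtain ⟨hm, hn⟩ := rho_monic_natDegree μ n
  obtain ⟨q, hq⟩ := dvd_iff_isRoot.2 hw
  have hq0 : q ≠ 0 := by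
    rintro rfl
    exact hm.ne_zero (by rw [hq, mul_zero])
  have hdeg : q.natDegree < n := by
    rw [← hn, hq, natDegree_mul (X_sub_C_ne_zero w) hq0, natDegree_X_sub_C]
    omega
  have h0 := ip_rho_of_natDegree_lt hμ hdeg
  have h0' : ip μ q (rho μ n) = 0 := by rw [← ip_conj, h0, map_zero]
  have e : X * q = rho μ n + C w * q := by
    rw [hq]
    ring
  -- Pythagoras for `z q = ρ n + w q`: multiplication by `z` is an isometry and `q` is orthogonal to
  -- `ρ n`.
  have key : ip μ q q = ip μ (rho μ n) (rho μ n) + w * conj w * ip μ q q := by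
    conv_lhs => rw [← ip_X_mul hμ q q, e, ip_add_left hμ, ip_add_right hμ, ip_add_right hμ,
      ip_C_mul_left, ip_C_mul_left, ip_C_mul_right, ip_C_mul_right, h0, h0']
    ring
  obtain ⟨r, hr, er⟩ := ip_self hμ hq0
  obtain ⟨s, hs, es⟩ := ip_self hμ hm.ne_zero
  rw [er, es, Complex.mul_conj'] at key
  have key' : r = s + ‖w‖ ^ 2 * r := by exact_mod_cast key
  by_contra! hc
  have : 1 ≤ ‖w‖ ^ 2 := one_le_pow₀ hc
  nlinarith

theorem ip_reciprocal_X_pow (hμ : IsCircleMeasure μ) {n k : ℕ} {P : ℂ[X]} (hP : P.natDegree ≤ n)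
    (hk : k ≤ n) : ip μ (reciprocal n P) (X ^ k) = ip μ (X ^ (n - k)) P := by
  refine ip_congr hμ fun z hz => ?_
  have hz0 := ne_zero_of_norm_eq_one hz
  rw [eval_reciprocal hP hz, eval_pow, eval_X, map_pow, conj_eq_inv hz, eval_pow, eval_X,
    ← Nat.sub_add_cancel hk, pow_add, Nat.add_sub_cancel_right,
    mul_right_comm, mul_assoc (z ^ (n - k)), ← mul_pow, mul_inv_cancel₀ hz0, one_pow, mul_one]

theorem ip_reciprocal_rho (hμ : IsCircleMeasure μ) {n k : ℕ} (hk0 : 1 ≤ k) (hk : k ≤ n) :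
    ip μ (reciprocal n (rho μ n)) (X ^ k) = 0 := by
  rw [ip_reciprocal_X_pow hμ (rho_monic_natDegree μ n).2.le hk, ← ip_conj,
    ip_rho_X_pow hμ (by omega), map_zero]

theorem coeff_natDegree_rho (μ : Measure ℂ) (n : ℕ) : (rho μ n).coeff n = 1 := by
  obtain ⟨hm, hd⟩ := rho_monic_natDegree μ n
  have h := hm.coeff_natDegree
  rwa [hd] at h

/-- This is `|ρ| < |ρ*|` at the origin, where `ρ*` equals `1`. It makes the determinant `1 - ‖ρ n 0‖
^ 2` below nonzero. -/
theorem norm_coeff_zero_rho_lt_one (hμ : IsCircleMeasure μ) {n : ℕ} (hn : 1 ≤ n) :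
    ‖(rho μ n).coeff 0‖ < 1 := by
  obtain ⟨hm, hd⟩ := rho_monic_natDegree μ n
  have h := (norm_eval_lt_norm_eval_reciprocal (z := 0) hm
    (fun z hz => norm_lt_one_of_isRoot_rho hμ hz) (by simp)).resolve_left (by
      intro h
      rw [h, natDegree_one] at hd
      omega)
  rw [hd, ← coeff_zero_eq_eval_zero, ← coeff_zero_eq_eval_zero, coeff_reciprocal (Nat.zero_le n),
    Nat.sub_zero] at h
  rwa [coeff_natDegree_rho, map_one, norm_one] at h

theorem coeff_zero_reciprocal_rho (μ : Measure ℂ) (n : ℕ) :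
    (reciprocal n (rho μ n)).coeff 0 = 1 := by
  rw [coeff_reciprocal (Nat.zero_le n), Nat.sub_zero, coeff_natDegree_rho, map_one]

theorem coeff_natDegree_reciprocal_rho (μ : Measure ℂ) (n : ℕ) :
    (reciprocal n (rho μ n)).coeff n = conj ((rho μ n).coeff 0) := by
  rw [coeff_reciprocal le_rfl, Nat.sub_self]

theorem one_sub_coeff_zero_ne_zero (hμ : IsCircleMeasure μ) {n : ℕ} (hn : 1 ≤ n) :
    1 - conj ((rho μ n).coeff 0) * (rho μ n).coeff 0 ≠ 0 :=
  one_sub_conj_mul_ne_zero (norm_coeff_zero_rho_lt_one hμ hn) (norm_coeff_zero_rho_lt_one hμ hn).le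

theorem rho_reciprocal_independent (hμ : IsCircleMeasure μ) {n : ℕ} (hn : 1 ≤ n) {x y : ℂ}
    (h : C x * rho μ n + C y * reciprocal n (rho μ n) = 0) : x = 0 ∧ y = 0 := by
  have h0 := congrArg (fun p => p.coeff 0) h
  have h1 := congrArg (fun p => p.coeff n) h
  simp only [coeff_add, coeff_C_mul, coeff_zero, coeff_natDegree_rho, coeff_zero_reciprocal_rho,
    coeff_natDegree_reciprocal_rho] at h0 h1
  have hd := one_sub_coeff_zero_ne_zero hμ hn
  have hx : x = 0 := by
    refine (mul_eq_zero.1 ?_).resolve_right hd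
    linear_combination h1 - conj ((rho μ n).coeff 0) * h0
  rw [hx] at h0
  exact ⟨hx, by simpa using h0⟩

/-- The polynomials of degree at most `n` which are orthogonal to `z, …, z ^ (n - 1)` are spanned
by `ρ n` and its reciprocal. -/
theorem exists_rho_reciprocal_combination (hμ : IsCircleMeasure μ) {n : ℕ} (hn : 1 ≤ n) {S : ℂ[X]}
    (hS : S.natDegree ≤ n) (h : ∀ j, 1 ≤ j → j < n → ip μ S (X ^ j) = 0) :
    ∃ x y : ℂ, S = C x * rho μ n + C y * reciprocal n (rho μ n) := by
  have hd := one_sub_coeff_zero_ne_zero hμ hn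
  set r := (rho μ n).coeff 0 with hr
  -- Cramer's rule for matching the coefficients of `1` and `z ^ n`. The remainder `T` then involves
  -- only `z, …, z ^ (n - 1)`, to all of which it is orthogonal, so it is orthogonal to itself.
  obtain ⟨x, hx⟩ : ∃ x, x = (S.coeff n - conj r * S.coeff 0) / (1 - conj r * r) := ⟨_, rfl⟩
  obtain ⟨y, hy⟩ : ∃ y, y = (S.coeff 0 - r * S.coeff n) / (1 - conj r * r) := ⟨_, rfl⟩
  refine ⟨x, y, sub_eq_zero.1 ?_⟩
  set T := S - (C x * rho μ n + C y * reciprocal n (rho μ n)) with hT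
  have hTdeg : T.natDegree ≤ n := by
    have h1 := (rho_monic_natDegree μ n).2.le
    refine (natDegree_sub_le_of_le hS (natDegree_add_le_of_le
      ((natDegree_C_mul_le _ _).trans h1)
      ((natDegree_C_mul_le _ _).trans (natDegree_reciprocal_le h1)))).trans ?_
    simp
  have hT0 : T.coeff 0 = 0 := by
    rw [hT, coeff_sub, coeff_add, coeff_C_mul, coeff_C_mul, coeff_zero_reciprocal_rho, ← hr, hx, hy]
    field_simp
    ring
  have hTn : T.coeff n = 0 := by
    rw [hT, coeff_sub, coeff_add, coeff_C_mul, coeff_C_mul, coeff_natDegree_reciprocal_rho,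
      coeff_natDegree_rho, ← hr, hx, hy]
    field_simp
    ring
  by_contra hne
  refine hμ.ip_self_ne_zero hne ?_
  rw [ip_eq_sum hμ, Finset.sum_eq_zero]
  intro k hk
  have hk : k ≤ n := (Nat.lt_succ_iff.1 (Finset.mem_range.1 hk)).trans hTdeg
  rcases Nat.eq_zero_or_pos k with rfl | hk0
  · rw [hT0, map_zero, zero_mul]
  rcases hk.eq_or_lt with rfl | hk
  · rw [hTn, map_zero, zero_mul]
  · rw [hT, hμ.ip_sub, ip_add_left hμ, ip_C_mul_left, ip_C_mul_left, h k hk0 hk,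
      ip_rho_X_pow hμ hk, ip_reciprocal_rho hμ hk0 hk.le]
    simp

end InnerProduct

/-! ### Quasi-paraorthogonal polynomials of order `3` -/

section QuasiParaorthogonal

variable {μ : Measure ℂ} {τ η : ℂ} {N : ℕ}

/-- The first half `z (z - η) ρ_N(z)` of the polynomial `Q3`. -/
def Q3Half (μ : Measure ℂ) (N : ℕ) (η : ℂ) : ℂ[X] := X * (X - C η) * rho μ N

theorem monic_Q3Half (μ : Measure ℂ) (N : ℕ) (η : ℂ) : (Q3Half μ N η).Monic :=
  (monic_X.mul (monic_X_sub_C η)).mul (rho_monic_natDegree μ N).1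

theorem natDegree_Q3Half (μ : Measure ℂ) (N : ℕ) (η : ℂ) : (Q3Half μ N η).natDegree = N + 2 := by
  rw [Q3Half, (monic_X.mul (monic_X_sub_C η)).natDegree_mul (rho_monic_natDegree μ N).1,
    monic_X.natDegree_mul (monic_X_sub_C η), natDegree_X, natDegree_X_sub_C,
    (rho_monic_natDegree μ N).2]
  omega

theorem reciprocal_Q3Half (μ : Measure ℂ) (N : ℕ) (η : ℂ) :
    reciprocal (N + 2) (Q3Half μ N η) =
      (1 - C (conj η) * X) * reciprocal N (rho μ N) := by
  have hX : reciprocal 1 X = 1 := by simpa using reciprocal_X_sub_C 0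
  rw [Q3Half, show N + 2 = (1 + 1) + N by omega, reciprocal_mul _ (rho_monic_natDegree μ N).2.le,
    reciprocal_mul natDegree_X.le (natDegree_X_sub_C η).le, hX, reciprocal_X_sub_C, one_mul]
  rw [monic_X.natDegree_mul (monic_X_sub_C η), natDegree_X, natDegree_X_sub_C]

theorem Q3_eq (μ : Measure ℂ) (N : ℕ) (τ η : ℂ) :
    Q3 μ (N + 2) τ η =
      Q3Half μ N η + C τ * reciprocal (Q3Half μ N η).natDegree (Q3Half μ N η) := by
  rw [natDegree_Q3Half, reciprocal_Q3Half, Q3Half, Q3, Nat.add_sub_cancel, mul_assoc (C τ)]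

theorem coeff_zero_Q3Half (μ : Measure ℂ) (N : ℕ) (η : ℂ) : (Q3Half μ N η).coeff 0 = 0 := by
  rw [Q3Half, mul_assoc, coeff_X_mul_zero]

theorem monic_Q3 (μ : Measure ℂ) (N : ℕ) (τ η : ℂ) : (Q3 μ (N + 2) τ η).Monic := by
  rw [Q3_eq]
  exact (degree_add_C_mul_reciprocal τ (monic_Q3Half μ N η) (coeff_zero_Q3Half μ N η)).1

theorem natDegree_Q3 (μ : Measure ℂ) (N : ℕ) (τ η : ℂ) :
    (Q3 μ (N + 2) τ η).natDegree = N + 2 := by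
  rw [Q3_eq, (degree_add_C_mul_reciprocal τ (monic_Q3Half μ N η) (coeff_zero_Q3Half μ N η)).2,
    natDegree_Q3Half]

theorem hasSimpleZerosOnCircle_Q3 (hμ : IsCircleMeasure μ) (hτ : ‖τ‖ = 1) (hη : ‖η‖ < 1) :
    HasSimpleZerosOnCircle (N + 2) (Q3 μ (N + 2) τ η) := by
  have h := hasSimpleZerosOnCircle hτ (monic_Q3Half μ N η) ?_ (coeff_zero_Q3Half μ N η)
  · rwa [← Q3_eq, natDegree_Q3Half] at h
  · intro z hz
    rw [Q3Half, root_mul, root_mul] at hz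
    rcases hz with (hz | hz) | hz
    · rw [IsRoot.def, eval_X] at hz
      simp [hz]
    · rw [root_X_sub_C] at hz
      rwa [← hz]
    · exact norm_lt_one_of_isRoot_rho hμ hz

theorem isQPOPUC_Q3 (hμ : IsCircleMeasure μ) (hτ : ‖τ‖ = 1) :
    IsQPOPUC μ (N + 2) 1 τ (Q3 μ (N + 2) τ η) where
  degree_eq := by rw [degree_eq_natDegree (monic_Q3 μ N τ η).ne_zero, natDegree_Q3]
  norm_eq_one := hτ
  invariant := by
    rw [Q3_eq, natDegree_Q3Half, reciprocal_add, reciprocal_C_mul, reciprocal_reciprocal, mul_add,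
      ← mul_assoc, ← C_mul, conj_eq_inv hτ, mul_inv_cancel₀ (ne_zero_of_norm_eq_one hτ), C_1,
      one_mul, add_comm]
  orthogonal := by
    intro k hk1 hk2
    obtain ⟨j, rfl⟩ : ∃ j, k = j + 2 := ⟨k - 2, by omega⟩
    -- The summands involve `z²ρ`, `zρ`, `ρ*` and `zρ*`; the powers to which all four are orthogonal
    -- include `z², …, z ^ N`.
    have e : Q3 μ (N + 2) τ η = (X * (X * rho μ N) - C η * (X * rho μ N)) +
        C τ * (reciprocal N (rho μ N) - C (conj η) * (X * reciprocal N (rho μ N))) := by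
      rw [Q3, Nat.add_sub_cancel]
      ring
    have h1 : ip μ (X * rho μ N) (X ^ (j + 2)) = 0 := by
      rw [pow_succ', ip_X_mul hμ, ip_rho_X_pow hμ (by omega)]
    have h2 : ip μ (X * (X * rho μ N)) (X ^ (j + 2)) = 0 := by
      rw [pow_succ', ip_X_mul hμ, pow_succ', ip_X_mul hμ, ip_rho_X_pow hμ (by omega)]
    have h3 : ip μ (X * reciprocal N (rho μ N)) (X ^ (j + 2)) = 0 := by
      rw [pow_succ', ip_X_mul hμ, ip_reciprocal_rho hμ (by omega) (by omega)]
    rw [e, ip_add_left hμ, hμ.ip_sub, ip_C_mul_left, ip_C_mul_left, hμ.ip_sub, ip_C_mul_left, h1,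
      h2, h3, ip_reciprocal_rho hμ (by omega) (by omega)]
    simp

/-- Removing `z²ρ_N` and `τρ_N*` kills the leading and constant terms. What remains is `z` times a
polynomial of degree at most `N` orthogonal to `z, …, z ^ (N - 1)`, hence in the span of `ρ_N` and
`ρ_N*`. -/
theorem IsQPOPUC.exists_expansion {P : ℂ[X]} (h : IsQPOPUC μ (N + 2) 1 τ P)
    (hμ : IsCircleMeasure μ) (hN : 1 ≤ N) (hP : P.Monic) :
    ∃ x y, P = Q3Half μ N (-x) + C τ * reciprocal N (rho μ N) +
      C y * (X * reciprocal N (rho μ N)) := by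
  have hPn : P.natDegree = N + 2 := natDegree_eq_of_degree_eq_some h.degree_eq
  obtain ⟨hρ, hρn⟩ := rho_monic_natDegree μ N
  have hPc : P.coeff (N + 2) = 1 := by
    rw [← hPn]
    exact hP
  have hP0 : P.coeff 0 = τ := by
    rw [h.invariant, coeff_C_mul, coeff_reciprocal (Nat.zero_le _), Nat.sub_zero, hPc, map_one,
      mul_one]
  have hX2 : (X ^ 2 * rho μ N).Monic := (monic_X_pow 2).mul hρ
  have hX2n : (X ^ 2 * rho μ N).natDegree = N + 2 := by
    rw [(monic_X_pow 2).natDegree_mul hρ, natDegree_X_pow, hρn, add_comm]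
  obtain ⟨W, hW⟩ : ∃ W, W = P - X ^ 2 * rho μ N - C τ * reciprocal N (rho μ N) := ⟨_, rfl⟩
  have hWn : W.natDegree ≤ N + 1 := by
    rw [hW, sub_eq_add_neg]
    refine natDegree_add_le_of_degree_le ?_ ?_
    · have hlt : (P - X ^ 2 * rho μ N).degree < P.degree := by
        refine degree_sub_lt_left ?_ hP.ne_zero ?_
        · rw [degree_eq_natDegree hP.ne_zero, degree_eq_natDegree hX2.ne_zero, hPn, hX2n]
        · rw [hP.leadingCoeff, hX2.leadingCoeff]
      rw [h.degree_eq] at hlt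
      exact natDegree_le_iff_coeff_eq_zero.2 fun m hm =>
        (degree_lt_iff_coeff_zero _ _).1 hlt m hm
    · rw [natDegree_neg]
      exact (natDegree_C_mul_le _ _).trans ((natDegree_reciprocal_le hρn.le).trans N.le_succ)
  have hW0 : W.coeff 0 = 0 := by
    rw [hW, coeff_sub, coeff_sub, hP0, coeff_C_mul, coeff_zero_reciprocal_rho, sq, mul_assoc,
      coeff_X_mul_zero]
    ring
  have hWS : W = X * W.divX := by
    conv_lhs => rw [← X_mul_divX_add W, hW0, C_0, add_zero]
  obtain ⟨x, y, hS⟩ := exists_rho_reciprocal_combination hμ hN (S := W.divX)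
    (by rw [natDegree_divX_eq_natDegree_tsub_one]; omega) (by
      intro j hj1 hj2
      obtain ⟨i, rfl⟩ : ∃ i, j = i + 1 := ⟨j - 1, by omega⟩
      have h1 : ip μ (X ^ 2 * rho μ N) (X * X ^ (i + 1)) = 0 := by
        rw [sq, mul_assoc, ip_X_mul hμ, pow_succ', ip_X_mul hμ, ip_rho_X_pow hμ (by omega)]
      rw [← ip_X_mul hμ, ← hWS, hW, hμ.ip_sub, hμ.ip_sub, h1, ← pow_succ',
        h.orthogonal _ (by omega) (by omega), ip_C_mul_left,
        ip_reciprocal_rho hμ (by omega) (by omega)]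
      simp)
  refine ⟨x, y, ?_⟩
  have e : P = W + X ^ 2 * rho μ N + C τ * reciprocal N (rho μ N) := by
    rw [hW]
    ring
  rw [e, hWS, hS, Q3Half, C_neg]
  ring

theorem reciprocal_X_mul_reciprocal_rho (μ : Measure ℂ) (N : ℕ) :
    reciprocal (N + 2) (X * reciprocal N (rho μ N)) = X * rho μ N := by
  have hX : reciprocal 1 X = 1 := by simpa using reciprocal_X_sub_C 0
  have hX1 : reciprocal 1 1 = X := by rw [← hX, reciprocal_reciprocal]
  have hX2 : reciprocal 2 X = X := by
    conv_lhs => rw [← one_mul X]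
    rw [show 2 = 1 + 1 from rfl, reciprocal_mul (by simp) natDegree_X.le, hX, hX1, mul_one]
  rw [add_comm N 2, reciprocal_mul (natDegree_X.le.trans one_le_two)
    (natDegree_reciprocal_le (rho_monic_natDegree μ N).2.le), reciprocal_reciprocal, hX2]

/-- Every monic invariant quasi-paraorthogonal polynomial of order `3` is of the form `Q3`. -/
theorem exists_eq_Q3 (hμ : IsCircleMeasure μ) (hN : 1 ≤ N) {P : ℂ[X]} (hP : P.Monic)
    (h : IsQPOPUC μ (N + 2) 1 τ P) : ∃ η, P = Q3 μ (N + 2) τ η := by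
  obtain ⟨x, y, hPe⟩ := h.exists_expansion hμ hN hP
  have hPQ : P = Q3 μ (N + 2) τ (-x) + C (y - τ * conj x) * (X * reciprocal N (rho μ N)) := by
    rw [hPe, Q3_eq, natDegree_Q3Half, reciprocal_Q3Half, map_neg, C_neg, C_sub, C_mul]
    ring
  generalize y - τ * conj x = d at hPQ
  have hQ := (isQPOPUC_Q3 (N := N) (η := -x) hμ h.norm_eq_one).invariant
  have hinv := h.invariant
  rw [hPQ, reciprocal_add, reciprocal_C_mul, reciprocal_X_mul_reciprocal_rho, mul_add, ← hQ,
    add_right_inj] at hinv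
  -- Invariance of the error term reads `d zρ* = τ (conj d) zρ`, which forces `d = 0` by
  -- independence.
  have hd0 := (rho_reciprocal_independent hμ hN (x := -(τ * conj d)) (y := d) (by
    refine mul_left_cancel₀ X_ne_zero ?_
    rw [C_neg, C_mul]
    linear_combination hinv)).2
  exact ⟨-x, by rw [hPQ, hd0, C_0, zero_mul, add_zero]⟩

theorem reciprocal_rho_eval_ne_zero (hμ : IsCircleMeasure μ) (N : ℕ) {α : ℂ} (hα : ‖α‖ = 1) :
    (reciprocal N (rho μ N)).eval α ≠ 0 := by
  obtain ⟨hm, hn⟩ := rho_monic_natDegree μ N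
  have h := eval_reciprocal_ne_zero hm (fun z hz => norm_lt_one_of_isRoot_rho hμ hz) hα.le
  rwa [hn] at h

theorem norm_blaschke (hμ : IsCircleMeasure μ) (N : ℕ) {α : ℂ} (hα : ‖α‖ = 1) :
    ‖blaschke μ (N + 1) α‖ = 1 := by
  have h := reciprocal_rho_eval_ne_zero hμ N hα
  have hn : ‖(reciprocal N (rho μ N)).eval α‖ = ‖(rho μ N).eval α‖ := by
    rw [eval_reciprocal (rho_monic_natDegree μ N).2.le hα, norm_mul, norm_pow, hα, one_pow,
      one_mul, RCLike.norm_conj]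
  rw [blaschke, Nat.add_sub_cancel, norm_div, norm_mul, hα, one_mul, ← hn,
    div_self (norm_ne_zero_iff.2 h)]

/-- Substituting `α ρ = F ρ*` lets the nonzero factor `F ρ*` be taken out; `1 / F = conj F` on the
circle. -/
theorem isRoot_Q3_iff (hμ : IsCircleMeasure μ) {α : ℂ} (hα : ‖α‖ = 1) :
    (Q3 μ (N + 2) τ η).IsRoot α ↔
      (α - η) + τ * conj (blaschke μ (N + 1) α) * (1 - conj η * α) = 0 := by
  have h := reciprocal_rho_eval_ne_zero hμ N hα
  have hF := norm_blaschke hμ N hα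
  have hF0 := ne_zero_of_norm_eq_one hF
  have e : α * (rho μ N).eval α =
      blaschke μ (N + 1) α * (reciprocal N (rho μ N)).eval α := by
    rw [blaschke, Nat.add_sub_cancel, div_mul_cancel₀ _ h]
  have key : (Q3 μ (N + 2) τ η).eval α =
      blaschke μ (N + 1) α * (reciprocal N (rho μ N)).eval α *
        ((α - η) + τ * conj (blaschke μ (N + 1) α) * (1 - conj η * α)) := by
    rw [conj_eq_inv hF, Q3, Nat.add_sub_cancel]
    simp only [eval_add, eval_mul, eval_sub, eval_X, eval_C, eval_one]
    rw [mul_right_comm α, e]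
    field_simp
  rw [IsRoot.def, key, mul_eq_zero, or_iff_right (mul_ne_zero hF0 h)]

end QuasiParaorthogonal

end UnitCircle

end

theorem theorem3p5 (μ : Measure ℂ) (hμ : UnitCircle.IsCircleMeasure μ)
    (n : ℕ) (hn : 3 ≤ n) (τ α₁ α₂ : ℂ)
    (hτ : ‖τ‖ = 1) (hα₁ : ‖α₁‖ = 1) (hα₂ : ‖α₂‖ = 1) (hα : α₁ ≠ α₂)
    (f₁ f₂ : ℂ)
    (hf₁ : f₁ = (starRingEnd ℂ) (UnitCircle.blaschke μ (n - 1) α₁))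
    (hf₂ : f₂ = (starRingEnd ℂ) (UnitCircle.blaschke μ (n - 1) α₂))
    (hf : f₁ ≠ f₂) (hαf : α₁ * f₁ ≠ α₂ * f₂)
    (η : ℂ)
    (hη : η = (starRingEnd ℂ) ((f₁ - f₂) / (f₁ * α₁ - f₂ * α₂)) +
      τ * (starRingEnd ℂ) ((α₁ - α₂) / (f₁ * α₁ - f₂ * α₂))) :
    -- the two forms of the condition on `τ` are equivalent
    (UnitCircle.OppositeOrientation α₁ (τ * f₁) α₂ α₁ (τ * f₁) (τ * f₂) ↔
      τ ∈ UnitCircle.arc (α₁ * (starRingEnd ℂ) f₂)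
        (-(((starRingEnd ℂ) f₁ - (starRingEnd ℂ) f₂) / (‖f₁ - f₂‖ : ℂ)) *
          ((α₁ - α₂) / (‖α₁ - α₂‖ : ℂ)))
        (α₂ * (starRingEnd ℂ) f₁)) ∧
    (UnitCircle.OppositeOrientation α₁ (τ * f₁) α₂ α₁ (τ * f₁) (τ * f₂) →
      ‖η‖ < 1 ∧
      -- existence
      (UnitCircle.Q3 μ n τ η).Monic ∧
      UnitCircle.IsQPOPUC μ n 1 τ (UnitCircle.Q3 μ n τ η) ∧
      UnitCircle.HasSimpleZerosOnCircle n (UnitCircle.Q3 μ n τ η) ∧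
      (UnitCircle.Q3 μ n τ η).IsRoot α₁ ∧ (UnitCircle.Q3 μ n τ η).IsRoot α₂ ∧
      -- uniqueness of the parameter `η` and of the polynomial
      (∀ η' : ℂ, (UnitCircle.Q3 μ n τ η').IsRoot α₁ → (UnitCircle.Q3 μ n τ η').IsRoot α₂ →
        η' = η) ∧
      (∀ P : ℂ[X], P.Monic → UnitCircle.IsQPOPUC μ n 1 τ P → P.IsRoot α₁ → P.IsRoot α₂ →
        P = UnitCircle.Q3 μ n τ η)) := by
  obtain ⟨N, rfl⟩ : ∃ N, n = N + 2 := ⟨n - 2, by omega⟩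
  rw [show N + 2 - 1 = N + 1 by omega] at hf₁ hf₂
  have hf₁n : ‖f₁‖ = 1 := by
    rw [hf₁, RCLike.norm_conj, UnitCircle.norm_blaschke hμ N hα₁]
  have hf₂n : ‖f₂‖ = 1 := by
    rw [hf₂, RCLike.norm_conj, UnitCircle.norm_blaschke hμ N hα₂]
  have hroots (η' : ℂ) : (UnitCircle.Q3 μ (N + 2) τ η').IsRoot α₁ ∧
      (UnitCircle.Q3 μ (N + 2) τ η').IsRoot α₂ ↔ η' = η := by
    rw [UnitCircle.isRoot_Q3_iff hμ hα₁, UnitCircle.isRoot_Q3_iff hμ hα₂, ← hf₁, ← hf₂,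
      ← UnitCircle.parameter_iff hτ hα₁ hα₂ hf₁n hf₂n hαf, ← hη]
  refine ⟨UnitCircle.oppositeOrientation_iff_mem_arc hτ hα₁ hα₂ hf₁n hf₂n hα hf hαf, fun h => ?_⟩
  have hlt : ‖η‖ < 1 := by
    refine UnitCircle.norm_lt_one_of_oppositeOrientation hτ hα₁ hα₂ hf₁n hf₂n hαf ?_ h
    obtain ⟨e₁, e₂⟩ := (UnitCircle.parameter_iff hτ hα₁ hα₂ hf₁n hf₂n hαf).1 hη
    -- The difference of the two vanishing conditions is the linear equation for `conj η`.
    linear_combination e₂ - e₁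
  obtain ⟨hr₁, hr₂⟩ := (hroots η).2 rfl
  refine ⟨hlt, UnitCircle.monic_Q3 μ N τ η, UnitCircle.isQPOPUC_Q3 hμ hτ,
    UnitCircle.hasSimpleZerosOnCircle_Q3 hμ hτ hlt, hr₁, hr₂,
    fun η' h₁ h₂ => (hroots η').1 ⟨h₁, h₂⟩, fun P hP hQ h₁ h₂ => ?_⟩
  obtain ⟨η', rfl⟩ := UnitCircle.exists_eq_Q3 hμ (by omega) hP hQ
  rw [(hroots η').1 ⟨h₁, h₂⟩]
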